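/- Let $n$ be a natural number, let $b\in\mathbb{R}^n\setminus\mathbb{Z}^n$ and let $S=b+\mathbb{Z}^n$. A closed convex set $K\subseteq\mathbb{R}^n$ is called an *$S$-free convex set* if $\operatorname{int}(K)\cap S=\emptyset$, and it is called *maximal* if it is not properly contained in any other $S$-free convex set. A *polyhedron* is the solution set of a finite system of (non-strict) linear inequalities. Then every maximal $S$-free convex set is a polyhedron. Moreover, if a maximal $S$-free convex set $K$ with $0\in\operatorname{int}(K)$ is given by $K=\{x\in\mathbb{R}^n : a_i x\le 1 \text{ for all } i\in I\}$ for some finite set $I$ and vectors $a_i\in\mathbb{R}^n$ ($i\in I$), where $a_ix$ denotes the scalar product, then the gauge $\psi$ of $K$, defined by $\psi(r)=\inf\{t>0 : r/t\in K\}$, satisfies $$\psi(r)=\max_{i\in I} a_i r\qquad\text{for all } r\in\mathbb{R}^n .$$ (In particular, $I$ is non-empty.) -/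

import Mathlib

/-- The set `ℤⁿ` of integral points of the Euclidean space `ℝⁿ`. -/
def integerPoints (n : ℕ) : Set (EuclideanSpace ℝ (Fin n)) :=
  {x | ∀ i, ∃ z : ℤ, x i = (z : ℝ)}

/-- The translate `b + ℤⁿ`. -/
def shiftedLattice {n : ℕ} (b : EuclideanSpace ℝ (Fin n)) : Set (EuclideanSpace ℝ (Fin n)) :=
  (fun z => b + z) '' integerPoints n

/-- `K` is an `S`-free convex set: a closed convex set with no point of `S` in its interior. -/
def IsSFreeConvex {n : ℕ} (S K : Set (EuclideanSpace ℝ (Fin n))) : Prop :=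
  IsClosed K ∧ Convex ℝ K ∧ interior K ∩ S = ∅

/-- `K` is an `S`-free convex set not properly contained in any `S`-free convex set. -/
def IsMaximalSFreeConvex {n : ℕ} (S K : Set (EuclideanSpace ℝ (Fin n))) : Prop :=
  IsSFreeConvex S K ∧ ∀ K', IsSFreeConvex S K' → ¬ K ⊂ K'

/-- `K` is a polyhedron: the solution set of finitely many linear inequalities `aᵢ x ≤ cᵢ`. -/
def IsPolyhedron {n : ℕ} (K : Set (EuclideanSpace ℝ (Fin n))) : Prop :=
  ∃ (m : ℕ) (a : Fin m → EuclideanSpace ℝ (Fin n)) (c : Fin m → ℝ),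
    K = {x | ∀ i, inner ℝ (a i) x ≤ c i}

/-!
Let `K` be a maximal `S`-free convex set, `S = b + ℤⁿ`. If `K` is nonempty without interior, it lies in a
hyperplane; hyperplanes are `S`-free, so `K` is one.

Suppose that `K` has interior points. If the cylinder `interior K + ℝ v` misses `S`, its closure is
again `S`-free, so by maximality `v` belongs to the lineality space `L` of `K`
(`IsMaximalSFreeConvex.mem_linealitySpace_of_disjoint`). This criterion is used twice.

* If `r` is a recession direction of `K`, then lattice vectors come arbitrarily close to far points
  of the ray through `r`, so a point of `S` in the cylinder could be translated into `interior K`.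
  Hence `r ∈ L` (`IsMaximalSFreeConvex.mem_linealitySpace_of_recession`). By compactness of the
  unit sphere, the projection of `K` to `Lᗮ` is bounded.
* If a line `ℝ v` lies in the closure of `ℤⁿ + L`, the same translation argument gives `v ∈ L`
  (`IsMaximalSFreeConvex.mem_linealitySpace_of_approx`). A non-discrete projection of `ℤⁿ` to `Lᗮ`
  would produce such a line inside `Lᗮ`, so that projection is discrete.

Thus, modulo `L`, the set `K` lies in a box that meets the image of `S` in finitely many points.
Separating each of them from `interior K` by a half-space and intersecting these half-spaces with
the box yields an `S`-free polyhedron containing `K`, which must be `K`.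

For the gauge formula, the only point that is special to maximal `S`-free sets is that
`max aᵢ r ≥ 0`, since the gauge is nonnegative. If all `aᵢ r ≤ 0`, then `r` is a recession direction,
so `-r` is one too, and all `aᵢ r` vanish (`IsMaximalSFreeConvex.inner_eq_zero_of_forall_nonpos`).
-/

/-! ### The integral lattice -/

/-- The additive group `ℤⁿ` of integral points of `ℝⁿ`. -/
def integerLattice (n : ℕ) : AddSubgroup (EuclideanSpace ℝ (Fin n)) where
  carrier := integerPoints n
  zero_mem' i := ⟨0, by simp⟩
  add_mem' {x y} hx hy i := by
    obtain ⟨p, hp⟩ := hx i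
    obtain ⟨q, hq⟩ := hy i
    exact ⟨p + q, by simp [hp, hq]⟩
  neg_mem' {x} hx i := by
    obtain ⟨p, hp⟩ := hx i
    exact ⟨-p, by simp [hp]⟩

lemma self_mem_shiftedLattice {n : ℕ} (b : EuclideanSpace ℝ (Fin n)) : b ∈ shiftedLattice b :=
  ⟨0, (integerLattice n).zero_mem, add_zero b⟩

lemma add_mem_shiftedLattice {n : ℕ} {b s z : EuclideanSpace ℝ (Fin n)}
    (hs : s ∈ shiftedLattice b) (hz : z ∈ integerLattice n) : s + z ∈ shiftedLattice b := by
  obtain ⟨w, hw, rfl⟩ := hs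
  exact ⟨w + z, (integerLattice n).add_mem hw hz, (add_assoc b w z).symm⟩

lemma sub_mem_integerLattice {n : ℕ} {b s t : EuclideanSpace ℝ (Fin n)}
    (hs : s ∈ shiftedLattice b) (ht : t ∈ shiftedLattice b) : s - t ∈ integerLattice n := by
  obtain ⟨w, hw, rfl⟩ := hs
  obtain ⟨z, hz, rfl⟩ := ht
  simpa using (integerLattice n).sub_mem hw hz

/-- Simultaneous Diophantine approximation: arbitrarily far along any ray from the origin there
are points arbitrarily close to `ℤⁿ`. -/
lemma exists_integerLattice_near_ray {n : ℕ} (r : EuclideanSpace ℝ (Fin n)) (T : ℝ) {ε : ℝ}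
    (hε : 0 < ε) : ∃ z ∈ integerLattice n, ∃ τ ≥ T, ‖z - τ • r‖ < ε := by
  -- The points `k T' r`, reduced modulo `ℤⁿ`, stay in a compact cube.
  set T' := max T 1
  let F : ℕ → EuclideanSpace ℝ (Fin n) :=
    fun k => WithLp.toLp 2 fun i => Int.fract ((k * T') * r i)
  have hcpt : IsCompact (WithLp.toLp 2 '' (Set.univ.pi fun _ : Fin n => Set.Icc (0 : ℝ) 1) :
      Set (EuclideanSpace ℝ (Fin n))) :=
    (isCompact_univ_pi fun _ => isCompact_Icc).image (PiLp.continuous_toLp 2 _)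
  have hF : ∀ k, F k ∈ (WithLp.toLp 2 '' (Set.univ.pi fun _ : Fin n => Set.Icc (0 : ℝ) 1) :
      Set (EuclideanSpace ℝ (Fin n))) := fun k =>
    ⟨_, fun i _ => ⟨Int.fract_nonneg _, (Int.fract_lt_one _).le⟩, rfl⟩
  obtain ⟨_, -, φ, hφ, hlim⟩ := hcpt.tendsto_subseq hF
  obtain ⟨N, hN⟩ := Metric.cauchySeq_iff.1 hlim.cauchySeq ε hε
  have hlt : φ N < φ (N + 1) := hφ (Nat.lt_succ_self N)
  have hd := hN N le_rfl (N + 1) (Nat.le_succ N)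
  have hk : (1 : ℝ) ≤ (φ (N + 1) : ℝ) - φ N := by
    have : (φ N : ℝ) + 1 ≤ φ (N + 1) := by exact_mod_cast hlt
    linarith
  refine ⟨WithLp.toLp 2 fun i => ((⌊(φ (N + 1) * T') * r i⌋ - ⌊(φ N * T') * r i⌋ : ℤ) : ℝ),
    fun i => ⟨_, rfl⟩, ((φ (N + 1) : ℝ) - φ N) * T', ?_, ?_⟩
  · have h1 : 1 ≤ T' := le_max_right _ _
    have h2 : T ≤ T' := le_max_left _ _
    nlinarith
  · rw [dist_eq_norm] at hd
    refine lt_of_eq_of_lt (congrArg norm ?_) hd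
    ext i
    simp only [F, Function.comp, PiLp.sub_apply, PiLp.smul_apply, smul_eq_mul, Int.fract]
    push_cast
    ring

/-! ### Lineality spaces -/

/-- The lineality space of `K`: the vectors along which `K` is invariant under all translations. -/
def linealitySpace {E : Type*} [AddCommGroup E] [Module ℝ E] (K : Set E) : Submodule ℝ E where
  carrier := {v | ∀ x ∈ K, ∀ t : ℝ, x + t • v ∈ K}
  zero_mem' x hx t := by simpa using hx
  add_mem' {v w} hv hw x hx t := by
    rw [smul_add, ← add_assoc]
    exact hw _ (hv x hx t) t
  smul_mem' c v hv x hx t := by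
    rw [smul_smul]
    exact hv x hx _

lemma add_mem_of_mem_linealitySpace {E : Type*} [AddCommGroup E] [Module ℝ E] {K : Set E}
    {x v : E} (hx : x ∈ K) (hv : v ∈ linealitySpace K) : x + v ∈ K := by
  simpa using hv x hx 1

lemma add_mem_interior_of_mem_linealitySpace {E : Type*} [NormedAddCommGroup E]
    [NormedSpace ℝ E] {K : Set E} {x v : E} (hx : x ∈ interior K) (hv : v ∈ linealitySpace K) :
    x + v ∈ interior K := by
  have hsub : (fun y => y + v) '' interior K ⊆ K := by
    rintro _ ⟨y, hy, rfl⟩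
    exact add_mem_of_mem_linealitySpace (interior_subset hy) hv
  exact interior_maximal hsub ((Homeomorph.addRight v).isOpenMap _ isOpen_interior) ⟨x, hx, rfl⟩

lemma exists_pos_add_smul_mem {E : Type*} [NormedAddCommGroup E] [NormedSpace ℝ E] {A : Set E}
    {x : E} (hx : x ∈ interior A) (d : E) : ∃ t : ℝ, 0 < t ∧ x + t • d ∈ A := by
  have hc : Filter.Tendsto (fun t : ℝ => x + t • d) (nhds 0) (nhds x) := by
    have : Continuous fun t : ℝ => x + t • d := by fun_prop
    simpa using this.tendsto 0
  obtain ⟨ε, hε, h⟩ := Metric.eventually_nhds_iff.1 (hc (mem_interior_iff_mem_nhds.1 hx))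
  refine ⟨ε / 2, by positivity, h ?_⟩
  rw [Real.dist_eq, sub_zero, abs_of_pos (by positivity)]
  linarith

/-! ### Lineality directions of maximal `S`-free convex sets -/

namespace IsMaximalSFreeConvex

lemma eq_of_subset {n : ℕ} {S K K' : Set (EuclideanSpace ℝ (Fin n))}
    (hK : IsMaximalSFreeConvex S K) (hK' : IsSFreeConvex S K') (h : K ⊆ K') : K = K' := by
  by_contra hne
  exact hK.2 K' hK' (h.ssubset_of_ne hne)

open scoped Pointwise in
/-- If the cylinder over `interior K` in direction `v` misses `S`, then its closure is `S`-free
and hence equal to `K`. -/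
lemma mem_linealitySpace_of_disjoint {n : ℕ} {S K : Set (EuclideanSpace ℝ (Fin n))}
    (hK : IsMaximalSFreeConvex S K) (hne : (interior K).Nonempty) {v : EuclideanSpace ℝ (Fin n)}
    (hv : ∀ x ∈ interior K, ∀ t : ℝ, x + t • v ∉ S) : v ∈ linealitySpace K := by
  obtain ⟨⟨hcl, hconv, -⟩, -⟩ := id hK
  set U := interior K + (Submodule.span ℝ {v} : Set (EuclideanSpace ℝ (Fin n))) with hU
  have hUo : IsOpen U := isOpen_interior.add_right
  have hUc : Convex ℝ U := hconv.interior.add (Submodule.span ℝ {v}).convex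
  have hsub : interior K ⊆ U := fun x hx => ⟨x, hx, 0, Submodule.zero_mem _, add_zero x⟩
  have hint : interior (closure U) = U := by
    rw [hUc.interior_closure_eq_interior_of_nonempty_interior, hUo.interior_eq]
    rw [hUo.interior_eq]
    exact hne.mono hsub
  have hKU : K = closure U := by
    refine hK.eq_of_subset ⟨isClosed_closure, hUc.closure, ?_⟩ ?_
    · rw [hint, Set.eq_empty_iff_forall_notMem]
      rintro _ ⟨⟨x, hx, w, hw, rfl⟩, hs⟩
      obtain ⟨t, rfl⟩ := Submodule.mem_span_singleton.1 hw
      exact hv x hx t hs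
    · rw [← hcl.closure_eq, ← hconv.closure_interior_eq_closure_of_nonempty_interior hne]
      exact closure_mono hsub
  intro x hx t
  rw [hKU] at hx ⊢
  refine map_mem_closure (f := fun y => y + t • v) (by fun_prop) hx ?_
  rintro _ ⟨y, hy, w, hw, rfl⟩
  exact ⟨y, hy, w + t • v, Submodule.add_mem _ hw
    (Submodule.smul_mem _ t (Submodule.mem_span_singleton_self v)), (add_assoc _ _ _).symm⟩

variable {n : ℕ} {b : EuclideanSpace ℝ (Fin n)} {K : Set (EuclideanSpace ℝ (Fin n))}

/-- Every recession direction of a full-dimensional maximal `S`-free convex set is a lineality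
direction. -/
lemma mem_linealitySpace_of_recession (hK : IsMaximalSFreeConvex (shiftedLattice b) K)
    (hne : (interior K).Nonempty) {r : EuclideanSpace ℝ (Fin n)}
    (hr : ∀ x ∈ K, ∀ t : ℝ, 0 ≤ t → x + t • r ∈ K) : r ∈ linealitySpace K := by
  refine hK.mem_linealitySpace_of_disjoint hne fun x hx t hs => ?_
  -- A lattice vector `z` close to `τ r` with `τ ≥ -t` moves `x + t r` back into the interior.
  obtain ⟨ε, hε, hball⟩ := Metric.isOpen_iff.1 isOpen_interior x hx
  obtain ⟨z, hz, τ, hτ, hlt⟩ := exists_integerLattice_near_ray r (-t) hε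
  have hsub : (fun y => y + (t + τ) • r) '' interior K ⊆ K := by
    rintro _ ⟨y, hy, rfl⟩
    exact hr y (interior_subset hy) _ (by linarith)
  have hmem : x + (z - τ • r) ∈ interior K := hball (by simpa [dist_eq_norm] using hlt)
  have hint : x + (z - τ • r) + (t + τ) • r ∈ interior K :=
    interior_maximal hsub ((Homeomorph.addRight ((t + τ) • r)).isOpenMap _ isOpen_interior)
      ⟨_, hmem, rfl⟩
  have heq : x + (z - τ • r) + (t + τ) • r = x + t • r + z := by module
  rw [heq] at hint
  exact Set.eq_empty_iff_forall_notMem.1 hK.1.2.2 _ ⟨hint, add_mem_shiftedLattice hs hz⟩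

/-- A line contained in the closure of `ℤⁿ + L`, where `L` is the lineality space of `K`, is
contained in `L`. -/
lemma mem_linealitySpace_of_approx (hK : IsMaximalSFreeConvex (shiftedLattice b) K)
    (hne : (interior K).Nonempty) {v : EuclideanSpace ℝ (Fin n)}
    (hv : ∀ t : ℝ, ∀ ε > 0, ∃ z ∈ integerLattice n, ∃ l ∈ linealitySpace K,
      ‖z - l - t • v‖ < ε) : v ∈ linealitySpace K := by
  refine hK.mem_linealitySpace_of_disjoint hne fun x hx t hs => ?_
  obtain ⟨ε, hε, hball⟩ := Metric.isOpen_iff.1 isOpen_interior x hx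
  obtain ⟨z, hz, l, hl, hlt⟩ := hv (-t) ε hε
  have hmem : x + (z - l - (-t) • v) ∈ interior K := hball (by simpa [dist_eq_norm] using hlt)
  have hint := add_mem_interior_of_mem_linealitySpace hmem hl
  have heq : x + (z - l - (-t) • v) + l = x + t • v + z := by module
  rw [heq] at hint
  exact Set.eq_empty_iff_forall_notMem.1 hK.1.2.2 _ ⟨hint, add_mem_shiftedLattice hs hz⟩

end IsMaximalSFreeConvex

/-! ### Projection along the lineality space -/

lemma sub_starProjection_orthogonal_mem {E : Type*} [NormedAddCommGroup E]
    [InnerProductSpace ℝ E] [FiniteDimensional ℝ E] (L : Submodule ℝ E) (x : E) :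
    x - Lᗮ.starProjection x ∈ L := by
  have := Lᗮ.sub_starProjection_mem_orthogonal x
  rwa [Submodule.orthogonal_orthogonal] at this

lemma starProjection_orthogonal_sub_mem {E : Type*} [NormedAddCommGroup E]
    [InnerProductSpace ℝ E] [FiniteDimensional ℝ E] (L : Submodule ℝ E) (x : E) :
    Lᗮ.starProjection x - x ∈ L := by
  rw [← neg_sub]
  exact neg_mem (sub_starProjection_orthogonal_mem L x)

namespace IsMaximalSFreeConvex

variable {n : ℕ} {b : EuclideanSpace ℝ (Fin n)} {K : Set (EuclideanSpace ℝ (Fin n))}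

/-- The projection of `ℤⁿ` orthogonal to the lineality space is discrete: otherwise short
projected vectors accumulate in a direction `v`, and integer multiples of them approximate the
whole line `ℝ v`, which would then lie in the lineality space. -/
lemma exists_forall_norm_starProjection_lt (hK : IsMaximalSFreeConvex (shiftedLattice b) K)
    (hne : (interior K).Nonempty) :
    ∃ ε > 0, ∀ z ∈ integerLattice n, ‖(linealitySpace K)ᗮ.starProjection z‖ < ε →
      (linealitySpace K)ᗮ.starProjection z = 0 := by
  by_contra! hcon
  set P := (linealitySpace K)ᗮ.starProjection with hP
  choose z hz hzlt hz0 using fun k : ℕ => hcon (1 / ((k : ℝ) + 1)) Nat.one_div_pos_of_nat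
  have hpos : ∀ k, 0 < ‖P (z k)‖ := fun k => norm_pos_iff.2 (hz0 k)
  obtain ⟨v, hvs, φ, hφ, hlim⟩ := (isCompact_sphere (0 : EuclideanSpace ℝ (Fin n)) 1).tendsto_subseq
    (x := fun k => ‖P (z k)‖⁻¹ • P (z k)) fun k => by
      simp [norm_smul, (hpos k).ne']
  have hvperp : v ∈ (linealitySpace K)ᗮ :=
    (linealitySpace K).isClosed_orthogonal.mem_of_tendsto hlim
      (Filter.Eventually.of_forall fun k =>
        Submodule.smul_mem _ _ (Submodule.starProjection_apply_mem _ _))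
  have hsmall : Filter.Tendsto (fun k => ‖P (z (φ k))‖) Filter.atTop (nhds 0) :=
    squeeze_zero (fun _ => norm_nonneg _) (fun k => (hzlt _).le)
      (tendsto_one_div_add_atTop_nhds_zero_nat.comp hφ.tendsto_atTop)
  have hvL : v ∈ linealitySpace K := by
    refine hK.mem_linealitySpace_of_approx hne fun t ε hε => ?_
    have h1 : Filter.Tendsto
        (fun k => ‖P (z (φ k))‖ + ‖t • (‖P (z (φ k))‖⁻¹ • P (z (φ k))) - t • v‖)
        Filter.atTop (nhds 0) := by
      have := hsmall.add ((hlim.const_smul t).sub_const (t • v)).norm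
      simpa using this
    obtain ⟨k, hk⟩ := (h1.eventually_lt_const hε).exists
    set y := z (φ k)
    have hy : 0 < ‖P y‖ := hpos (φ k)
    set m : ℤ := ⌊t / ‖P y‖⌋
    refine ⟨m • y, (integerLattice n).zsmul_mem (hz _) m, (m : ℝ) • (y - P y),
      Submodule.smul_mem _ _ (sub_starProjection_orthogonal_mem _ _), lt_of_le_of_lt ?_ hk⟩
    have heq : m • y - (m : ℝ) • (y - P y) - t • v =
        (-Int.fract (t / ‖P y‖)) • P y + (t • (‖P y‖⁻¹ • P y) - t • v) := by
      rw [← Int.cast_smul_eq_zsmul ℝ m y, Int.fract, smul_smul, div_eq_mul_inv]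
      simp only [m, div_eq_mul_inv]
      module
    rw [heq]
    refine (norm_add_le _ _).trans (add_le_add ?_ le_rfl)
    rw [norm_smul, norm_neg, Real.norm_of_nonneg (Int.fract_nonneg _)]
    exact mul_le_of_le_one_left hy.le (Int.fract_lt_one _).le
  have hv0 : v = 0 :=
    Submodule.disjoint_def.1 (linealitySpace K).orthogonal_disjoint v hvL hvperp
  simp [hv0] at hvs

/-- Only finitely many points of the projection of `S` lie in a given ball. -/
lemma finite_starProjection_image (hK : IsMaximalSFreeConvex (shiftedLattice b) K)
    (hne : (interior K).Nonempty) (R : ℝ) :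
    {p ∈ (linealitySpace K)ᗮ.starProjection '' shiftedLattice b | ‖p‖ ≤ R}.Finite := by
  obtain ⟨ε, hε, hsep⟩ := hK.exists_forall_norm_starProjection_lt hne
  by_contra hinf
  let u := Set.Infinite.natEmbedding _ hinf
  obtain ⟨_, -, φ, hφ, hlim⟩ :=
    (isCompact_closedBall (0 : EuclideanSpace ℝ (Fin n)) R).tendsto_subseq
      (x := fun k => (u k : EuclideanSpace ℝ (Fin n))) fun k => by simpa using (u k).2.2
  obtain ⟨N, hN⟩ := Metric.cauchySeq_iff.1 hlim.cauchySeq ε hε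
  have hd := hN N le_rfl (N + 1) (Nat.le_succ N)
  obtain ⟨s, hs, hsu⟩ := (u (φ N)).2.1
  obtain ⟨t, ht, htu⟩ := (u (φ (N + 1))).2.1
  simp only [Function.comp, dist_eq_norm, ← hsu, ← htu, ← map_sub] at hd
  have h0 := hsep _ (sub_mem_integerLattice hs ht) hd
  rw [map_sub, sub_eq_zero, hsu, htu] at h0
  exact (hφ (Nat.lt_succ_self N)).ne (u.injective (Subtype.ext h0))

/-- The projection of `K` orthogonal to its lineality space is bounded: otherwise `K` has a
recession direction orthogonal to the lineality space. -/
lemma exists_norm_starProjection_le (hK : IsMaximalSFreeConvex (shiftedLattice b) K)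
    (hne : (interior K).Nonempty) :
    ∃ R, ∀ x ∈ K, ‖(linealitySpace K)ᗮ.starProjection x‖ ≤ R := by
  by_contra! hcon
  set P := (linealitySpace K)ᗮ.starProjection with hP
  choose x hxK hx using fun k : ℕ => hcon ((k : ℝ) + 1)
  have hpos : ∀ k, 0 < ‖P (x k)‖ := fun k => lt_trans (by positivity) (hx k)
  obtain ⟨v, hvs, φ, hφ, hlim⟩ := (isCompact_sphere (0 : EuclideanSpace ℝ (Fin n)) 1).tendsto_subseq
    (x := fun k => ‖P (x k)‖⁻¹ • P (x k)) fun k => by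
      simp [norm_smul, (hpos k).ne']
  have hvperp : v ∈ (linealitySpace K)ᗮ :=
    (linealitySpace K).isClosed_orthogonal.mem_of_tendsto hlim
      (Filter.Eventually.of_forall fun k =>
        Submodule.smul_mem _ _ (Submodule.starProjection_apply_mem _ _))
  have hPK : ∀ k, P (x k) ∈ K := fun k => by
    have := add_mem_of_mem_linealitySpace (hxK k)
      (starProjection_orthogonal_sub_mem (linealitySpace K) (x k))
    rwa [add_sub_cancel] at this
  have hlarge : Filter.Tendsto (fun k => ‖P (x (φ k))‖) Filter.atTop Filter.atTop := by
    refine Filter.tendsto_atTop_mono (fun k => ?_) tendsto_natCast_atTop_atTop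
    have h1 := hx (φ k)
    have h2 : (k : ℝ) ≤ φ k := by exact_mod_cast hφ.id_le k
    linarith
  have hvL : v ∈ linealitySpace K := by
    refine hK.mem_linealitySpace_of_recession hne fun y hy t ht => ?_
    -- `y + t v` is the limit of the points of the segments from `y` to `P (x k)` at parameter
    -- `t / ‖P (x k)‖`.
    have hlim' : Filter.Tendsto (fun k => (1 - t * ‖P (x (φ k))‖⁻¹) • y +
        (t * ‖P (x (φ k))‖⁻¹) • P (x (φ k))) Filter.atTop (nhds (y + t • v)) := by
      have h1 := (hlarge.inv_tendsto_atTop.const_mul t).const_sub 1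
      have h2 := (h1.smul_const y).add (hlim.const_smul t)
      simpa [Function.comp_def, smul_smul] using h2
    refine hK.1.1.mem_of_tendsto hlim' ?_
    filter_upwards [hlarge.eventually_ge_atTop t] with k hk
    have hle : t * ‖P (x (φ k))‖⁻¹ ≤ 1 := by
      rw [← div_eq_mul_inv]
      exact div_le_one_of_le₀ hk (norm_nonneg _)
    exact hK.1.2.1 hy (hPK _) (by linarith) (by positivity) (by ring)
  have hv0 : v = 0 :=
    Submodule.disjoint_def.1 (linealitySpace K).orthogonal_disjoint v hvL hvperp
  simp [hv0] at hvs

end IsMaximalSFreeConvex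

/-! ### Polyhedrality -/

lemma isPolyhedron_setOf_forall_le {n : ℕ} {ι : Type*} [Finite ι]
    (f : ι → StrongDual ℝ (EuclideanSpace ℝ (Fin n))) (c : ι → ℝ) :
    IsPolyhedron {x | ∀ j, f j x ≤ c j} := by
  obtain ⟨m, ⟨e⟩⟩ := Finite.exists_equiv_fin ι
  refine ⟨m, fun i => (InnerProductSpace.toDual ℝ _).symm (f (e.symm i)), fun i => c (e.symm i), ?_⟩
  ext x
  simp only [Set.mem_ofPred_eq, InnerProductSpace.toDual_symm_apply]
  exact ⟨fun h i => h _, fun h j => by simpa using h (e j)⟩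

lemma isClosed_setOf_forall_le {E ι : Type*} [NormedAddCommGroup E] [NormedSpace ℝ E]
    (f : ι → StrongDual ℝ E) (c : ι → ℝ) : IsClosed {x | ∀ j, f j x ≤ c j} := by
  rw [Set.ofPred_forall]
  exact isClosed_iInter fun j => isClosed_le (f j).continuous continuous_const

lemma convex_setOf_forall_le {E ι : Type*} [NormedAddCommGroup E] [NormedSpace ℝ E]
    (f : ι → StrongDual ℝ E) (c : ι → ℝ) : Convex ℝ {x | ∀ j, f j x ≤ c j} := by
  rw [Set.ofPred_forall]
  exact convex_iInter fun j => convex_halfSpace_le (f j).isLinear (c j)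

namespace IsMaximalSFreeConvex

variable {n : ℕ} {b : EuclideanSpace ℝ (Fin n)} {K : Set (EuclideanSpace ℝ (Fin n))}

/-- A maximal `S`-free convex set with empty interior is empty or a hyperplane, since
hyperplanes are `S`-free. -/
lemma isPolyhedron_of_interior_eq_empty {S : Set (EuclideanSpace ℝ (Fin n))}
    (hK : IsMaximalSFreeConvex S K) (hint : interior K = ∅) : IsPolyhedron K := by
  rcases K.eq_empty_or_nonempty with rfl | ⟨x₀, hx₀⟩
  · exact ⟨1, fun _ => 0, fun _ => -1, by ext x; simp⟩
  have hspan : affineSpan ℝ K ≠ ⊤ := fun h => by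
    have := hK.1.2.1.interior_nonempty_iff_affineSpan_eq_top.2 h
    simp [hint] at this
  have hdir : (affineSpan ℝ K).direction ≠ ⊤ := fun h => hspan
    ((AffineSubspace.direction_eq_top_iff_of_nonempty ⟨x₀, subset_affineSpan ℝ K hx₀⟩).1 h)
  obtain ⟨a, ha, ha0⟩ := Submodule.exists_mem_ne_zero_of_ne_bot
    (mt (Submodule.orthogonal_eq_bot_iff).1 hdir)
  set f : Fin 2 → StrongDual ℝ (EuclideanSpace ℝ (Fin n)) := ![innerSL ℝ a, -innerSL ℝ a] with hf
  set c : Fin 2 → ℝ := ![inner ℝ a x₀, -inner ℝ a x₀] with hc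
  suffices h : K = {x | ∀ j, f j x ≤ c j} by
    rw [h]
    exact isPolyhedron_setOf_forall_le f c
  refine hK.eq_of_subset ⟨isClosed_setOf_forall_le f c, convex_setOf_forall_le f c, ?_⟩ ?_
  · rw [Set.eq_empty_iff_forall_notMem]
    rintro s ⟨hs, -⟩
    obtain ⟨t, ht, hmem⟩ := exists_pos_add_smul_mem hs a
    have h1 := hmem 0
    have h2 := interior_subset hs 1
    have h3 : 0 < t * inner ℝ a a := mul_pos ht (real_inner_self_pos.2 ha0)
    simp [hf, hc, inner_add_right, inner_smul_right] at h1 h2 h3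
    linarith
  · intro x hx
    have h0 : inner ℝ a (x - x₀) = 0 := by
      rw [real_inner_comm]
      exact ha _ (AffineSubspace.vsub_mem_direction (subset_affineSpan ℝ K hx)
        (subset_affineSpan ℝ K hx₀))
    rw [inner_sub_right, sub_eq_zero] at h0
    intro j
    fin_cases j <;> simp [hf, hc, h0]

/-- Full-dimensional case: modulo the lineality space, `K` is bounded and only finitely many
points of `S` lie in a box around it. Cutting each of these off by a half-space containing `K`
gives an `S`-free polyhedron containing `K`. -/
lemma isPolyhedron_of_interior_nonempty (hK : IsMaximalSFreeConvex (shiftedLattice b) K)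
    (hne : (interior K).Nonempty) : IsPolyhedron K := by
  obtain ⟨R, hR⟩ := hK.exists_norm_starProjection_le hne
  set P := (linealitySpace K)ᗮ.starProjection with hP
  -- The box below is cut out by bounds on the coordinates of `P x`; `R'` bounds its norm.
  set R' := √(∑ _i : Fin n, R ^ 2)
  have hPint : ∀ x ∈ interior K, P x ∈ interior K := fun x hx => by
    have := add_mem_interior_of_mem_linealitySpace hx
      (starProjection_orthogonal_sub_mem (linealitySpace K) x)
    rwa [add_sub_cancel] at this
  let F := {p ∈ P '' shiftedLattice b | ‖p‖ ≤ R'}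
  have hFfin : F.Finite := hK.finite_starProjection_image hne R'
  have : Finite F := hFfin
  have hFint : ∀ p : F, (p : EuclideanSpace ℝ (Fin n)) ∉ interior K := by
    rintro ⟨_, ⟨s, hs, rfl⟩, hn⟩ hp
    have := add_mem_interior_of_mem_linealitySpace hp
      (sub_starProjection_orthogonal_mem (linealitySpace K) s)
    rw [← hP, add_sub_cancel] at this
    exact Set.eq_empty_iff_forall_notMem.1 hK.1.2.2 _ ⟨this, hs⟩
  choose g hg using fun p : F =>
    geometric_hahn_banach_open_point hK.1.2.1.interior isOpen_interior (hFint p)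
  let f : (Fin n ⊕ Fin n) ⊕ F → StrongDual ℝ (EuclideanSpace ℝ (Fin n)) :=
    Sum.elim (Sum.elim (fun i => (EuclideanSpace.proj i).comp P)
      fun i => -(EuclideanSpace.proj i).comp P) fun p => (g p).comp P
  let c : (Fin n ⊕ Fin n) ⊕ F → ℝ := Sum.elim (fun _ => R) fun p => g p p
  suffices h : K = {x | ∀ j, f j x ≤ c j} by
    rw [h]
    exact isPolyhedron_setOf_forall_le f c
  refine hK.eq_of_subset ⟨isClosed_setOf_forall_le f c, convex_setOf_forall_le f c, ?_⟩ ?_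
  · rw [Set.eq_empty_iff_forall_notMem]
    rintro s ⟨hs, hsS⟩
    have hsQ := interior_subset hs
    have hnorm : ‖P s‖ ≤ R' := by
      rw [EuclideanSpace.norm_eq]
      refine Real.sqrt_le_sqrt (Finset.sum_le_sum fun i _ => ?_)
      have h1 : P s i ≤ R := hsQ (Sum.inl (Sum.inl i))
      have h2 : -P s i ≤ R := hsQ (Sum.inl (Sum.inr i))
      rw [Real.norm_eq_abs]
      exact pow_le_pow_left₀ (abs_nonneg _) (abs_le.2 ⟨by linarith, h1⟩) 2
    let p : F := ⟨P s, ⟨s, hsS, rfl⟩, hnorm⟩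
    -- `s` lies on the boundary of the half-space for `p`, so moving away from an interior point
    -- of `K` leaves that half-space at once.
    obtain ⟨x, hx⟩ := hne
    obtain ⟨t, ht, hmem⟩ := exists_pos_add_smul_mem hs (s - x)
    have h1 : g p (P (s + t • (s - x))) ≤ g p (P s) := hmem (Sum.inr p)
    have h2 : g p (P x) < g p (P s) := hg p _ (hPint x hx)
    simp only [map_add, map_smul, map_sub, smul_eq_mul] at h1
    nlinarith [mul_pos ht (sub_pos.2 h2)]
  · have hsub : interior K ⊆ {x | ∀ j, f j x ≤ c j} := by
      intro x hx j
      have hle i : |P x i| ≤ R :=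
        (PiLp.norm_apply_le (P x) i).trans (hR x (interior_subset hx))
      rcases j with (i | i) | p
      · exact (le_abs_self _).trans (hle i)
      · exact (neg_le_abs _).trans (hle i)
      · exact (hg p _ (hPint x hx)).le
    rw [← hK.1.1.closure_eq, ← hK.1.2.1.closure_interior_eq_closure_of_nonempty_interior hne]
    exact closure_minimal hsub (isClosed_setOf_forall_le f c)

end IsMaximalSFreeConvex

/-! ### The gauge -/

namespace IsMaximalSFreeConvex

variable {n : ℕ} {b : EuclideanSpace ℝ (Fin n)} {K : Set (EuclideanSpace ℝ (Fin n))}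

/-- The supremum of the `aᵢ r` cannot be negative: a direction `r` with all `aᵢ r ≤ 0` is a
recession direction, hence a lineality direction, and so all `aᵢ r` vanish. -/
lemma inner_eq_zero_of_forall_nonpos (hK : IsMaximalSFreeConvex (shiftedLattice b) K)
    (h0 : 0 ∈ interior K) {I : Type*} {a : I → EuclideanSpace ℝ (Fin n)}
    (ha : K = {x | ∀ i, inner ℝ (a i) x ≤ 1}) {r : EuclideanSpace ℝ (Fin n)}
    (hr : ∀ i, inner ℝ (a i) r ≤ 0) (i : I) : inner ℝ (a i) r = 0 := by
  have hL : r ∈ linealitySpace K := by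
    refine hK.mem_linealitySpace_of_recession ⟨0, h0⟩ fun x hx t ht => ?_
    rw [ha] at hx ⊢
    intro j
    rw [inner_add_right, inner_smul_right]
    have := hx j
    have := mul_nonpos_of_nonneg_of_nonpos ht (hr j)
    linarith
  by_contra hne
  have hmem := hL 0 (interior_subset h0) (2 / inner ℝ (a i) r)
  rw [ha] at hmem
  have := hmem i
  rw [zero_add, inner_smul_right, div_mul_cancel₀ _ hne] at this
  norm_num at this

end IsMaximalSFreeConvex

theorem mainTheorem3 {n : ℕ} (b : EuclideanSpace ℝ (Fin n)) (hb : b ∉ integerPoints n) :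
    (∀ K : Set (EuclideanSpace ℝ (Fin n)),
      IsMaximalSFreeConvex (shiftedLattice b) K → IsPolyhedron K) ∧
    (∀ K : Set (EuclideanSpace ℝ (Fin n)),
      IsMaximalSFreeConvex (shiftedLattice b) K → (0 : EuclideanSpace ℝ (Fin n)) ∈ interior K →
      ∀ (I : Type*) [Finite I] (a : I → EuclideanSpace ℝ (Fin n)),
        K = {x | ∀ i, inner ℝ (a i) x ≤ 1} →
        ∀ r : EuclideanSpace ℝ (Fin n),
          IsGreatest (Set.range fun i => inner ℝ (a i) r) (gauge K r)) := by
  refine ⟨fun K hK => ?_, fun K hK h0 I _ a ha r => ?_⟩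
  · rcases (interior K).eq_empty_or_nonempty with h | h
    · exact hK.isPolyhedron_of_interior_eq_empty h
    · exact hK.isPolyhedron_of_interior_nonempty h
  -- For empty `I` the set `K` would be the whole space, which meets `S`.
  have hI : Nonempty I := by
    by_contra hI
    rw [not_nonempty_iff] at hI
    have huniv : K = Set.univ := by rw [ha]; ext x; simp
    have hfree := hK.1.2.2
    rw [huniv, interior_univ, Set.univ_inter] at hfree
    exact Set.eq_empty_iff_forall_notMem.1 hfree b (self_mem_shiftedLattice b)
  obtain ⟨i₀, hi₀⟩ := Finite.exists_max fun i => inner ℝ (a i) r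
  have hM : 0 ≤ inner ℝ (a i₀) r := by
    by_contra hlt
    push Not at hlt
    exact hlt.ne (hK.inner_eq_zero_of_forall_nonpos h0 ha (fun i => (hi₀ i).trans hlt.le) i₀)
  have habs : Absorbent ℝ K := absorbent_nhds_zero (mem_interior_iff_mem_nhds.1 h0)
  have hle : ∀ i, inner ℝ (a i) r ≤ gauge K r := fun i => by
    refine le_of_forall_gt fun t ht => ?_
    obtain ⟨s, hs, hst, y, hy, rfl⟩ := exists_lt_of_gauge_lt habs ht
    rw [ha] at hy
    have := hy i
    simp only [inner_smul_right]
    nlinarith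
  have hge : gauge K r ≤ inner ℝ (a i₀) r := by
    refine le_of_forall_pos_le_add fun ε hε => ?_
    have hpos : 0 < inner ℝ (a i₀) r + ε := by linarith
    refine gauge_le_of_mem hpos.le ((Set.mem_smul_set_iff_inv_smul_mem₀ hpos.ne' _ _).2 ?_)
    rw [ha]
    intro i
    rw [inner_smul_right, inv_mul_le_iff₀ hpos]
    have := hi₀ i
    linarith
  refine ⟨⟨i₀, le_antisymm (hle i₀) hge⟩, ?_⟩
  rintro _ ⟨i, rfl⟩
  exact hle i
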